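/- For $L\ge 2$ and $\alpha\in\mathbb R$ let $\mu_L(\alpha)=(1-\alpha)(1,\alpha,\dots,\alpha^{L-1})\in\mathbb R^L$ be the impulse response of the scalar linear dynamical system with parameter $\alpha$, and let $\mu_L(\alpha_1,\dots,\alpha_h)\in\mathbb R^{h\times L}$ be the matrix with rows $\mu_L(\alpha_i)$. Let $Z\in\mathbb R^{L\times L}$, $Z_{ij}=\frac{2}{(i+j)^3-(i+j)}$ for $1\le i,j\le L$, and let $\phi_1,\dots,\phi_L$ be an orthonormal basis of eigenvectors of $Z$ in order of decreasing eigenvalue (the spectral filters of length $L$). For $k\le L$ let $\Phi_{1:k}\in\mathbb R^{k\times L}$ be the matrix with rows $\phi_1,\dots,\phi_k$. Consider the following algorithm. Draw independent random $\alpha_1,\dots,\alpha_h\in[0,1]$ whose laws have no atoms (for example, uniform). For each $i$ let $$m_i\in\arg\min_{m\in\mathbb R^k}\ \mathbb E_u\bigl[\,|m^\top\Phi_{1:k}u-\mu_L(\alpha_i)^\top u|^2\,\bigr],$$ where $u\in\mathbb R^L$ is a random input with $\mathbb E[uu^\top]=sI$ for some $s>0$ (for example, standard Gaussian). Let $M\in\mathbb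 R^{h\times k}$ be the matrix with rows $m_i$, and return its Moore--Penrose pseudo-inverse $\widetilde M\in\mathbb R^{k\times h}$. There is an absolute constant $c>0$ such that for all $L\ge 2$, all $k\le L$ and all $h\ge k$, and for every choice of spectral filters and of laws of $u$ and of the $\alpha_i$ as above, the following holds with probability one: the minimizers $m_i$ are unique, $M$ has full column rank (so that $\widetilde M M=I_k$), and $$\bigl\|\Phi_{1:k}-\widetilde M\,\mu_L(\alpha_1,\dots,\alpha_h)\bigr\|_F\ \le\ c\,\lambda_{\max}\,h\,e^{-k/\log L},$$ where $\lambda_{\max}$ is the largest singular value of $\widetilde M$ and $\|\cdot\|_F$ is the Frobenius norm (which dominates the operator norm). -/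

import Mathlib

open MeasureTheory ProbabilityTheory

noncomputable section

/-- The impulse response `μ_L(α) = (1 - α) (1, α, α², …, α^(L-1))` of the scalar linear dynamical
system `x_t = α x_{t-1} + u_t`, `y_t = (1 - α) x_t`. -/
def impulseResponse (L : ℕ) (α : ℝ) : Fin L → ℝ :=
  fun i => (1 - α) * α ^ (i : ℕ)

/-- The `h × L` matrix `μ_L(α₁, …, α_h)` whose `i`-th row is `μ_L(α_i)`. -/
def impulseMatrix (L : ℕ) {h : ℕ} (α : Fin h → ℝ) : Matrix (Fin h) (Fin L) ℝ :=
  Matrix.of fun i => impulseResponse L (α i)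

/-- The Hankel matrix of spectral filtering, `Z_{ij} = 2 / ((i + j)³ - (i + j))` for
`1 ≤ i, j ≤ L` (here the indices start at `0`). It equals `∫₀¹ μ_L(α) μ_L(α)ᵀ dα`. -/
def spectralHankel (L : ℕ) : Matrix (Fin L) (Fin L) ℝ :=
  Matrix.of fun i j =>
    2 / ((((i : ℕ) : ℝ) + ((j : ℕ) : ℝ) + 2) ^ 3 - (((i : ℕ) : ℝ) + ((j : ℕ) : ℝ) + 2))

/-- `Φ` holds the first `k` spectral filters of length `L`: its rows are the first `k` members of
an orthonormal basis of eigenvectors of the Hankel matrix, listed by decreasing eigenvalue. -/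
def IsSpectralFilters (L k : ℕ) (Φ : Matrix (Fin k) (Fin L) ℝ) : Prop :=
  ∃ (V : Matrix (Fin L) (Fin L) ℝ) (σ : Fin L → ℝ),
    V * V.transpose = 1 ∧ Antitone σ ∧
    (∀ j, (spectralHankel L).mulVec (V j) = σ j • V j) ∧
    ∃ hk : k ≤ L, ∀ j, Φ j = V (Fin.castLE hk j)

/-- The law `ν` of the random input `u ∈ ℝ^L` is white: the coordinates are square integrable and
`E[u uᵀ]` is a positive multiple of the identity (as for standard Gaussian inputs). -/
def IsWhite {L : ℕ} (ν : Measure (Fin L → ℝ)) : Prop :=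
  (∀ i, MemLp (fun u : Fin L → ℝ => u i) 2 ν) ∧
    ∃ s : ℝ, 0 < s ∧ ∀ i j, ∫ u, u i * u j ∂ν = if i = j then s else 0

/-- The expected squared error `E_u |mᵀ Φ u - μ_L(α)ᵀ u|²` of the spectral coefficients `m`. -/
def fitLoss {L k : ℕ} (ν : Measure (Fin L → ℝ)) (Φ : Matrix (Fin k) (Fin L) ℝ) (α : ℝ)
    (m : Fin k → ℝ) : ℝ :=
  ∫ u, |dotProduct m (Φ.mulVec u) - dotProduct (impulseResponse L α) u| ^ 2 ∂ν

/-- `m` is a spectral representation of the scalar system with parameter `α`: a minimizer of the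
expected squared error over `ℝ^k`. -/
def IsSpectralRepresentation {L k : ℕ} (ν : Measure (Fin L → ℝ)) (Φ : Matrix (Fin k) (Fin L) ℝ)
    (α : ℝ) (m : Fin k → ℝ) : Prop :=
  ∀ m' : Fin k → ℝ, fitLoss ν Φ α m ≤ fitLoss ν Φ α m'

/-- `B` is the Moore-Penrose pseudo-inverse of the real matrix `A`. -/
structure IsMoorePenroseInverse {m n : ℕ} (A : Matrix (Fin m) (Fin n) ℝ)
    (B : Matrix (Fin n) (Fin m) ℝ) : Prop where
  mul_mul_left : A * B * A = A
  mul_mul_right : B * A * B = B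
  symm_left : (A * B).transpose = A * B
  symm_right : (B * A).transpose = B * A

/-- With filters `Φ` and sampled parameters `α₁, …, α_h`, the algorithm computes the `h × k`
coefficient matrix `M`, whose rows are spectral representations of the `α_i`, and returns its
pseudo-inverse `Mt`. -/
structure IsAlgorithmRun {L k h : ℕ} (ν : Measure (Fin L → ℝ)) (Φ : Matrix (Fin k) (Fin L) ℝ)
    (α : Fin h → ℝ) (M : Matrix (Fin h) (Fin k) ℝ) (Mt : Matrix (Fin k) (Fin h) ℝ) : Prop where
  rows : ∀ i, IsSpectralRepresentation ν Φ (α i) (M i)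
  pinv : IsMoorePenroseInverse M Mt

/-- The largest singular value of a real matrix. -/
def maxSingularValue {m n : ℕ} (A : Matrix (Fin m) (Fin n) ℝ) : ℝ :=
  (Matrix.toEuclideanLin A).singularValues 0

/-- The Frobenius norm of a real matrix. -/
def frobNorm {m n : ℕ} (A : Matrix (Fin m) (Fin n) ℝ) : ℝ :=
  Real.sqrt (∑ i, ∑ j, A i j ^ 2)

end

/-! For white inputs and orthonormal filters the loss is a Euclidean distance, so its minimizer is
`m_i = Φ μ(α_i)`. Atomless independent samples make `M` injective almost surely. Then `Mt * M = 1`,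
and with `A` the impulse matrix, `Mt * A - Φ = Mt * (A - M * Φ)`. The rows of `A - M * Φ` are the
parts of `μ(α_i)` orthogonal to the first `k` filters, and it remains to bound their squared lengths
`Q(α_i)` (`tailEnergy`).

Since `Z = ∫ μ μᵀ`, the mean of `Q` over `[0,1]` is the sum of the eigenvalues from index `k` on.
`Z` lies below the Hilbert matrix, a Cauchy kernel at the points `i + 1/2`. Splitting off `j` rank
one kernels with dyadic Blaschke nodes damps this kernel, which gives `σ_j ≲ log L · exp(-4j / log
L)` (`eigenvalue_le_of_blaschke`, `eigenvalue_le_exp`).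

Hölder continuity of `μ` turns the mean into a pointwise bound at the price of a square root
(`tailEnergy_sq_le_integral`): `Q ≲ log L · exp(-2k / log L)`. The factor `log L` is at most `k ≤
h`, except when `k < log L`, where `Q ≤ 1` suffices. Summing over `h` rows and taking the root gives
`h · exp(-k / log L)`. -/

/-! ### Singular values, Frobenius norm and Moore-Penrose inverses. -/

/-- The largest singular value bounds the operator norm. -/
theorem norm_apply_le_singularValues_zero {E F : Type*} [NormedAddCommGroup E]
    [InnerProductSpace ℝ E] [FiniteDimensional ℝ E] [NormedAddCommGroup F] [InnerProductSpace ℝ F]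
    [FiniteDimensional ℝ F] (T : E →ₗ[ℝ] F) (v : E) :
    ‖T v‖ ≤ T.singularValues 0 * ‖v‖ := by
  have hs := T.isSymmetric_adjoint_comp_self
  have hσ := T.singularValues_nonneg 0
  refine abs_le_of_sq_le_sq' ?_ (by positivity) |>.2
  let b := hs.eigenvectorBasis rfl
  have h1 : ‖T v‖ ^ 2 = inner ℝ v ((LinearMap.adjoint T ∘ₗ T) v) := by
    rw [LinearMap.comp_apply, LinearMap.adjoint_inner_right, real_inner_self_eq_norm_sq]
  have h2 : ∀ i, inner ℝ (b i) ((LinearMap.adjoint T ∘ₗ T) v)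
      = hs.eigenvalues rfl i * inner ℝ (b i) v := by
    intro i
    have := hs.apply_eigenvectorBasis rfl i
    rw [← hs, this, inner_smul_left]
    simp [b]
  rw [h1, mul_pow, ← b.sum_inner_mul_inner v, ← real_inner_self_eq_norm_sq v,
    ← b.sum_inner_mul_inner v v, Finset.mul_sum]
  refine Finset.sum_le_sum fun i _ => ?_
  have h3 : hs.eigenvalues rfl i ≤ T.singularValues 0 ^ 2 := by
    rw [← T.sq_singularValues_fin rfl i]
    exact pow_le_pow_left₀ (T.singularValues_nonneg _) (T.singularValues_antitone (Nat.zero_le _)) 2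
  rw [h2, real_inner_comm v (b i)]
  nlinarith [mul_self_nonneg (inner ℝ v (b i))]

theorem sum_mulVec_sq_le {m n : ℕ} (B : Matrix (Fin m) (Fin n) ℝ) (x : Fin n → ℝ) :
    ∑ i, (B.mulVec x) i ^ 2 ≤ maxSingularValue B ^ 2 * ∑ i, x i ^ 2 := by
  have h := norm_apply_le_singularValues_zero (Matrix.toEuclideanLin B) (WithLp.toLp 2 x)
  have h2 := pow_le_pow_left₀ (norm_nonneg _) h 2
  rw [mul_pow, EuclideanSpace.norm_sq_eq, EuclideanSpace.norm_sq_eq] at h2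
  simpa [maxSingularValue, Matrix.toLpLin_toLp] using h2

theorem maxSingularValue_nonneg {m n : ℕ} (B : Matrix (Fin m) (Fin n) ℝ) :
    0 ≤ maxSingularValue B :=
  LinearMap.singularValues_nonneg _ _

theorem frobNorm_mul_le {m n l : ℕ} (B : Matrix (Fin m) (Fin n) ℝ) (X : Matrix (Fin n) (Fin l) ℝ) :
    frobNorm (B * X) ≤ maxSingularValue B * frobNorm X := by
  have hσ := maxSingularValue_nonneg B
  unfold frobNorm
  refine Real.sqrt_le_iff.2 ⟨by positivity, ?_⟩
  have hX : ∑ i, ∑ j, X i j ^ 2 = ∑ j, ∑ i, X i j ^ 2 := Finset.sum_comm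
  rw [mul_pow, Real.sq_sqrt (by positivity), Finset.sum_comm, hX, Finset.mul_sum]
  exact Finset.sum_le_sum fun j _ => sum_mulVec_sq_le B fun i => X i j

theorem frobNorm_sub_comm {m n : ℕ} (A B : Matrix (Fin m) (Fin n) ℝ) :
    frobNorm (A - B) = frobNorm (B - A) := by
  unfold frobNorm
  congr 1
  exact Finset.sum_congr rfl fun i _ => Finset.sum_congr rfl fun j _ => by
    simp only [Matrix.sub_apply]; ring

/-- `A * B` is the orthogonal projection onto the column space of `A` and `B * A` the one onto its
row space. Neither depends on the choice of inverse, and `B = B * A * B` recovers `B` from them. -/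
theorem IsMoorePenroseInverse.unique {m n : ℕ} {A : Matrix (Fin m) (Fin n) ℝ}
    {B C : Matrix (Fin n) (Fin m) ℝ} (hB : IsMoorePenroseInverse A B)
    (hC : IsMoorePenroseInverse A C) : B = C := by
  have h1 : A * B = A * C := by
    calc A * B = (A * B).transpose := hB.symm_left.symm
      _ = ((A * C) * (A * B)).transpose := by
          rw [← Matrix.mul_assoc, hC.mul_mul_left]
      _ = (A * B) * (A * C) := by
          rw [Matrix.transpose_mul, hB.symm_left, hC.symm_left]
      _ = A * C := by rw [← Matrix.mul_assoc, hB.mul_mul_left]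
  have h2 : B * A = C * A := by
    calc B * A = (B * A).transpose := hB.symm_right.symm
      _ = ((B * A) * (C * A)).transpose := by
          rw [Matrix.mul_assoc, ← Matrix.mul_assoc A, hC.mul_mul_left]
      _ = (C * A) * (B * A) := by
          rw [Matrix.transpose_mul, hB.symm_right, hC.symm_right]
      _ = C * A := by rw [Matrix.mul_assoc, ← Matrix.mul_assoc A, hB.mul_mul_left]
  calc B = B * A * B := hB.mul_mul_right.symm
    _ = C * A * C := by rw [h2, Matrix.mul_assoc, h1, Matrix.mul_assoc]
    _ = C := hC.mul_mul_right

/-- A matrix of full column rank has a Moore-Penrose inverse, and it is a left inverse. -/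
theorem exists_isMoorePenroseInverse_of_injective {m n : ℕ} (A : Matrix (Fin m) (Fin n) ℝ)
    (hA : ∀ v, A.mulVec v = 0 → v = 0) :
    ∃ B, IsMoorePenroseInverse A B ∧ B * A = 1 := by
  have hdet : IsUnit (A.transpose * A).det := by
    rw [isUnit_iff_ne_zero]
    intro h0
    obtain ⟨v, hv, h⟩ := Matrix.exists_mulVec_eq_zero_iff.2 h0
    refine hv (hA v ?_)
    have : dotProduct (A.mulVec v) (A.mulVec v) = 0 := by
      rw [Matrix.dotProduct_mulVec, Matrix.vecMul_mulVec, ← Matrix.dotProduct_mulVec, h,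
        dotProduct_zero]
    exact dotProduct_self_eq_zero.1 this
  have hl : ((A.transpose * A)⁻¹ * A.transpose) * A = 1 := by
    rw [Matrix.mul_assoc, Matrix.nonsing_inv_mul _ hdet]
  refine ⟨(A.transpose * A)⁻¹ * A.transpose, ⟨?_, ?_, ?_, ?_⟩, hl⟩
  · rw [Matrix.mul_assoc, hl, Matrix.mul_one]
  · rw [hl, Matrix.one_mul]
  · rw [Matrix.transpose_mul, Matrix.transpose_mul, Matrix.transpose_nonsing_inv,
      Matrix.transpose_mul, Matrix.transpose_transpose, Matrix.mul_assoc]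
  · rw [hl, Matrix.transpose_one]

/-! ### Almost sure nonsingularity of sampled matrices. -/

/-- Independent samples from atomless laws are almost surely unisolvent for a finite family of
functions whose nontrivial linear combinations have countably many zeros. -/
theorem ae_det_ne_zero (n : ℕ) (f : Fin n → ℝ → ℝ) (hf : ∀ j, Measurable (f j))
    (hz : ∀ c : Fin n → ℝ, c ≠ 0 → {x | ∑ j, c j * f j x = 0}.Countable)
    (μ : Fin n → Measure ℝ) [∀ i, IsProbabilityMeasure (μ i)] [∀ i, NullSingletonClass (μ i)] :
    ∀ᵐ x ∂Measure.pi μ, (Matrix.of fun i j => f j (x i)).det ≠ 0 := by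
  induction n with
  | zero => exact Filter.Eventually.of_forall fun x => by simp
  | succ n ih =>
    have ih' := ih (fun j => f j.succ) (fun j => hf _) (fun c hc => by
      have h := hz (Fin.cons 0 c) (fun h0 => hc (by
        funext j; simpa using congrFun h0 j.succ))
      simpa [Fin.sum_univ_succ] using h) (fun i => μ (Fin.succ i))
    have hmeas : ∀ (m : ℕ) (g : Fin m → ℝ → ℝ) (_ : ∀ j, Measurable (g j)),
        Measurable fun x : Fin m → ℝ => (Matrix.of fun i j => g j (x i)).det := by
      intro m g hg
      simp only [Matrix.det_apply]
      refine Finset.measurable_sum _ fun σ _ => Measurable.const_smul ?_ _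
      refine Finset.measurable_prod _ fun i _ => ?_
      exact (hg i).comp (measurable_pi_apply (σ i))
    let s : Set (Fin (n + 1) → ℝ) := {x | (Matrix.of fun i j => f j (x i)).det = 0}
    have hs : MeasurableSet s := measurableSet_eq_fun (hmeas _ f hf) measurable_const
    have mp := (measurePreserving_piFinSuccAbove μ 0).symm
    rw [ae_iff]
    change Measure.pi μ {x | ¬¬ _} = 0
    simp only [not_not]
    change Measure.pi μ s = 0
    rw [← mp.measure_preimage hs.nullMeasurableSet,
      Measure.prod_apply_symm (mp.measurable hs), lintegral_eq_zero_iff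
        (measurable_measure_prodMk_right (mp.measurable hs))]
    filter_upwards [ih'] with y hy
    -- With the other samples `y` fixed, Laplace expansion along row `0` makes the determinant a
    -- combination of the `f j` in the first sample. The coefficient of `f 0` is the minor that is
    -- nonzero by induction, so the bad set is countable, hence null; Fubini then concludes.
    refine Set.Countable.measure_zero (Set.Countable.mono ?_ (hz
      (fun j => (-1) ^ (j : ℕ) * (Matrix.of fun (i : Fin n) (l : Fin n) =>
        f (j.succAbove l) (y i)).det) ?_)) _
    · intro x hx
      change (Matrix.of fun i j => f j ((Fin.insertNth 0 x y : Fin (n + 1) → ℝ) i)).det = 0 at hx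
      rw [Matrix.det_succ_row_zero] at hx
      rw [Set.mem_ofPred_eq, ← hx]
      refine Finset.sum_congr rfl fun j _ => ?_
      have : (Matrix.of fun i j => f j ((Fin.insertNth 0 x y : Fin (n + 1) → ℝ) i)).submatrix
          Fin.succ j.succAbove = Matrix.of fun i l => f (j.succAbove l) (y i) := by
        ext i l; simp
      rw [this]
      simp
      ring
    · intro h0
      have := congrFun h0 0
      simp at this
      exact hy this

theorem ae_det_ne_zero_of_iIndepFun {n : ℕ} {Ω : Type*} [MeasurableSpace Ω] {P : Measure Ω}
    [IsProbabilityMeasure P] (f : Fin n → ℝ → ℝ) (hf : ∀ j, Measurable (f j))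
    (hz : ∀ c : Fin n → ℝ, c ≠ 0 → {x | ∑ j, c j * f j x = 0}.Countable)
    (X : Fin n → Ω → ℝ) (hX : ∀ i, Measurable (X i)) (hind : iIndepFun X P)
    (hatom : ∀ i (x : ℝ), P {ω | X i ω = x} = 0) :
    ∀ᵐ ω ∂P, (Matrix.of fun i j => f j (X i ω)).det ≠ 0 := by
  have hp : ∀ i, IsProbabilityMeasure (P.map (X i)) := fun i =>
    Measure.isProbabilityMeasure_map (hX i).aemeasurable
  have hna : ∀ i, NullSingletonClass (P.map (X i)) := fun i => ⟨fun x => by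
    rw [Measure.map_apply (hX i) (measurableSet_singleton x)]
    exact hatom i x⟩
  have h := ae_det_ne_zero n f hf hz fun i => P.map (X i)
  rw [← (iIndepFun_iff_map_fun_eq_pi_map fun i => (hX i).aemeasurable).1 hind] at h
  exact ae_of_ae_map (measurable_pi_lambda _ hX).aemeasurable h

/-! ### Eigenvalue decay of the Hankel matrix through Blaschke products. -/

noncomputable section

/-- The finite Blaschke product of the right half-plane with zeros `p 0, …, p (j - 1)`. -/
def blaschke (p : ℕ → ℝ) (j : ℕ) (x : ℝ) : ℝ :=
  ∏ m ∈ Finset.range j, (x - p m) / (x + p m)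

/-- The Cauchy kernel is a sum of `j` rank one kernels and a kernel damped by Blaschke products. -/
theorem cauchy_kernel_eq (p : ℕ → ℝ) (hp : ∀ m, 0 < p m) (j : ℕ) {x y : ℝ} (hx : 0 < x)
    (hy : 0 < y) :
    1 / (x + y) = (∑ m ∈ Finset.range j, 2 * p m * (blaschke p m x / (x + p m))
      * (blaschke p m y / (y + p m))) + blaschke p j x * blaschke p j y / (x + y) := by
  induction j with
  | zero => simp [blaschke]
  | succ j ih =>
    -- The new term comes from `(x + p)(y + p) - (x - p)(y - p) = 2p(x + y)`, divided by `(x + p)(y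
    -- + p)(x + y)`.
    rw [Finset.sum_range_succ, ih, add_assoc]
    congr 1
    have h1 : blaschke p (j + 1) x = blaschke p j x * ((x - p j) / (x + p j)) :=
      Finset.prod_range_succ _ _
    have h2 : blaschke p (j + 1) y = blaschke p j y * ((y - p j) / (y + p j)) :=
      Finset.prod_range_succ _ _
    rw [h1, h2]
    have := hp j
    have hxp : x + p j ≠ 0 := by positivity
    have hyp : y + p j ≠ 0 := by positivity
    have hxy : x + y ≠ 0 := by positivity
    field_simp
    ring

theorem abs_sub_div_add_le_one {x p : ℝ} (hx : 0 < x) (hp : 0 < p) :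
    |(x - p) / (x + p)| ≤ 1 := by
  rw [abs_div, abs_of_pos (by positivity : 0 < x + p), div_le_one (by positivity), abs_le]
  constructor <;> linarith

theorem exp_four_le : Real.exp 4 ≤ 58 := by
  have h := Real.exp_one_lt_d9
  have h1 : Real.exp 4 = Real.exp 1 ^ 4 := by rw [← Real.exp_nat_mul]; norm_num
  rw [h1]
  calc Real.exp 1 ^ 4 ≤ 2.7182818286 ^ 4 := pow_le_pow_left₀ (Real.exp_pos _).le h.le 4
    _ ≤ 58 := by norm_num

theorem prod_four_nodes_le {x p : ℝ} (hp : 0 < p) (h1 : p ≤ x) (h2 : x ≤ 2 * p) :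
    |(x - p / 2) / (x + p / 2)| * |(x - p) / (x + p)| * |(x - 2 * p) / (x + 2 * p)|
      * |(x - 4 * p) / (x + 4 * p)| ≤ Real.exp (-4) := by
  have hx : 0 < x := hp.trans_le h1
  -- The nodes pair up as `p/2, 4p` and `p, 2p`, each with product `2p²`. With `S = x² + 2p² ≥
  -- 2.8px`, the paired factors are `(4.5px - S)/(4.5px + S) ≤ 1.7/7.3` and `(3px - S)/(3px + S) ≤
  -- 0.2/5.8 = 1/29`.
  have ht : 2.8 * (p * x) ≤ x ^ 2 + 2 * p ^ 2 := by nlinarith [sq_nonneg (x - 1.4 * p)]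
  have hpx : 0 < p * x := by positivity
  have e1 : |(x - p / 2) / (x + p / 2)| * |(x - 4 * p) / (x + 4 * p)| ≤ 1 / 2 := by
    rw [← abs_mul, div_mul_div_comm, abs_div, abs_of_nonpos (by nlinarith),
      abs_of_pos (by positivity), div_le_iff₀ (by positivity)]
    nlinarith
  have e2 : |(x - p) / (x + p)| * |(x - 2 * p) / (x + 2 * p)| ≤ 1 / 29 := by
    rw [← abs_mul, div_mul_div_comm, abs_div, abs_of_nonpos (by nlinarith),
      abs_of_pos (by positivity), div_le_iff₀ (by positivity)]
    nlinarith
  have e3 : (1 : ℝ) / 58 ≤ Real.exp (-4) := by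
    rw [Real.exp_neg, one_div]
    exact inv_anti₀ (Real.exp_pos _) exp_four_le
  calc _ = (|(x - p / 2) / (x + p / 2)| * |(x - 4 * p) / (x + 4 * p)|)
        * (|(x - p) / (x + p)| * |(x - 2 * p) / (x + 2 * p)|) := by ring
    _ ≤ 1 / 2 * (1 / 29) := mul_le_mul e1 e2 (by positivity) (by norm_num)
    _ ≤ Real.exp (-4) := by linarith

/-- The periodically repeated dyadic grid with `N` points. -/
def dyadicNode (N m : ℕ) : ℝ := 2 ^ (m % N) / 4

theorem dyadicNode_pos (N m : ℕ) : 0 < dyadicNode N m := by unfold dyadicNode; positivity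

theorem abs_blaschke_anti {p : ℕ → ℝ} (hp : ∀ m, 0 < p m) {x : ℝ} (hx : 0 < x) {i j : ℕ}
    (hij : i ≤ j) : |blaschke p j x| ≤ |blaschke p i x| := by
  obtain ⟨d, rfl⟩ := Nat.exists_eq_add_of_le hij
  rw [blaschke, Finset.prod_range_add, abs_mul]
  refine mul_le_of_le_one_right (abs_nonneg _) ?_
  rw [Finset.abs_prod]
  exact Finset.prod_le_one (fun _ _ => abs_nonneg _) fun m _ => abs_sub_div_add_le_one hx (hp _)

theorem abs_blaschke_dyadic_period_le (L n : ℕ) (hn : n < L) :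
    |blaschke (dyadicNode (Nat.log 2 L + 5)) (Nat.log 2 L + 5) (n + 1 / 2)| ≤ Real.exp (-4) := by
  set N := Nat.log 2 L + 5 with hN
  set a := Nat.log 2 (2 * n + 1) with ha
  have hx : (0 : ℝ) < n + 1 / 2 := by positivity
  -- The point `x = n + 1/2` lies in `[2^a/2, 2^a]`. The nodes numbered `a` to `a + 3` surround it,
  -- and the `5` in `N` ensures that they belong to one period.
  have haN : a + 4 ≤ N := by
    have h1 : a ≤ Nat.log 2 (L * 2) := Nat.log_mono_right (by omega)
    rw [Nat.log_mul_base (by norm_num) (by omega)] at h1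
    omega
  refine (abs_blaschke_anti (dyadicNode_pos N) hx haN).trans ?_
  have hlo : (2 : ℝ) ^ a ≤ 2 * n + 1 := by
    exact_mod_cast Nat.pow_log_le_self 2 (by omega : 2 * n + 1 ≠ 0)
  have hhi : (2 * n + 1 : ℝ) ≤ 2 ^ (a + 1) := by
    exact_mod_cast (Nat.lt_pow_succ_log_self (by norm_num) (2 * n + 1)).le
  have hnode : ∀ m < N, dyadicNode N m = 2 ^ m / 4 := fun m hm => by
    rw [dyadicNode, Nat.mod_eq_of_lt hm]
  rw [blaschke, Finset.prod_range_add, abs_mul]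
  refine (mul_le_of_le_one_left (abs_nonneg _) ?_).trans ?_
  · rw [Finset.abs_prod]
    exact Finset.prod_le_one (fun _ _ => abs_nonneg _)
      fun m _ => abs_sub_div_add_le_one hx (dyadicNode_pos _ _)
  · simp only [Finset.prod_range_succ, Finset.prod_range_zero, one_mul, abs_mul]
    rw [hnode _ (by omega), hnode _ (by omega), hnode _ (by omega), hnode _ (by omega)]
    have key := prod_four_nodes_le (x := (n : ℝ) + 1 / 2) (p := 2 ^ a / 2) (by positivity)
      (by linarith) (by rw [pow_succ] at hhi; linarith)
    rw [show (2 : ℝ) ^ (a + 0) / 4 = 2 ^ a / 2 / 2 by ring,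
      show (2 : ℝ) ^ (a + 1) / 4 = 2 ^ a / 2 by ring,
      show (2 : ℝ) ^ (a + 2) / 4 = 2 * (2 ^ a / 2) by ring,
      show (2 : ℝ) ^ (a + 3) / 4 = 4 * (2 ^ a / 2) by ring]
    exact key

theorem abs_blaschke_dyadic_le (L n j : ℕ) (hn : n < L) :
    |blaschke (dyadicNode (Nat.log 2 L + 5)) j (n + 1 / 2)|
      ≤ Real.exp (-4) ^ (j / (Nat.log 2 L + 5)) := by
  have hper := abs_blaschke_dyadic_period_le L n hn
  set N := Nat.log 2 L + 5 with hN
  have hx : (0 : ℝ) < n + 1 / 2 := by positivity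
  -- Only the complete periods are kept; each contributes a factor `exp(-4)`.
  refine (abs_blaschke_anti (dyadicNode_pos N) hx (Nat.mul_div_le j N)).trans ?_
  generalize j / N = q
  induction q with
  | zero => simp [blaschke]
  | succ q ih =>
    rw [mul_add, mul_one, blaschke, Finset.prod_range_add, abs_mul, pow_succ]
    refine mul_le_mul ih ?_ (abs_nonneg _) (by positivity)
    refine le_of_eq_of_le ?_ hper
    unfold blaschke
    congr 1
    exact Finset.prod_congr rfl fun m _ => by simp [dyadicNode]

theorem integral_sq_sum_pow {L : ℕ} (v : Fin L → ℝ) :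
    ∫ α in (0 : ℝ)..1, (∑ i, v i * α ^ (i : ℕ)) ^ 2
      = ∑ i, ∑ l, v i * v l / ((i : ℕ) + (l : ℕ) + 1) := by
  have : ∀ α : ℝ, (∑ i, v i * α ^ (i : ℕ)) ^ 2
      = ∑ i, ∑ l, v i * v l * α ^ ((i : ℕ) + (l : ℕ)) := fun α => by
    rw [sq, Finset.sum_mul_sum]
    exact Finset.sum_congr rfl fun i _ => Finset.sum_congr rfl fun l _ => by ring
  simp only [this]
  rw [intervalIntegral.integral_finsetSum fun i _ => Continuous.intervalIntegrable (by fun_prop) _ _]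
  refine Finset.sum_congr rfl fun i _ => ?_
  rw [intervalIntegral.integral_finsetSum fun i _ => Continuous.intervalIntegrable (by fun_prop) _ _]
  refine Finset.sum_congr rfl fun l _ => ?_
  rw [intervalIntegral.integral_const_mul, integral_pow]
  push_cast
  simp [div_eq_mul_inv]

theorem integral_sq_dotProduct_impulseResponse {L : ℕ} (v : Fin L → ℝ) :
    ∫ α in (0 : ℝ)..1, dotProduct v (impulseResponse L α) ^ 2
      = dotProduct v ((spectralHankel L).mulVec v) := by
  have : ∀ α : ℝ, dotProduct v (impulseResponse L α) ^ 2
      = ∑ i, ∑ l, v i * v l * (α ^ ((i : ℕ) + (l : ℕ)) - 2 * α ^ ((i : ℕ) + (l : ℕ) + 1)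
        + α ^ ((i : ℕ) + (l : ℕ) + 2)) := fun α => by
    rw [sq, dotProduct, Finset.sum_mul_sum]
    exact Finset.sum_congr rfl fun i _ => Finset.sum_congr rfl fun l _ => by
      simp only [impulseResponse]; ring
  simp only [this]
  rw [intervalIntegral.integral_finsetSum fun i _ => Continuous.intervalIntegrable (by fun_prop) _ _]
  refine Finset.sum_congr rfl fun i _ => ?_
  rw [intervalIntegral.integral_finsetSum fun i _ => Continuous.intervalIntegrable (by fun_prop) _ _,
    Matrix.mulVec, dotProduct, Finset.mul_sum]
  refine Finset.sum_congr rfl fun l _ => ?_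
  rw [intervalIntegral.integral_const_mul, intervalIntegral.integral_add
      (Continuous.intervalIntegrable (by fun_prop) _ _)
      (Continuous.intervalIntegrable (by fun_prop) _ _),
    intervalIntegral.integral_sub (Continuous.intervalIntegrable (by fun_prop) _ _)
      (Continuous.intervalIntegrable (by fun_prop) _ _), intervalIntegral.integral_const_mul,
    integral_pow, integral_pow, integral_pow]
  simp only [spectralHankel, Matrix.of_apply]
  push_cast
  have h0 : (0 : ℝ) ≤ ((i : ℕ) : ℝ) + ((l : ℕ) : ℝ) := by positivity
  generalize ((i : ℕ) : ℝ) + ((l : ℕ) : ℝ) = s at *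
  have e : (s + 2) ^ 3 - (s + 2) = (s + 1) * (s + 2) * (s + 3) := by ring
  rw [e]
  have a1 : s + 1 ≠ 0 := by positivity
  have a2 : s + 2 ≠ 0 := by positivity
  have a3 : s + 3 ≠ 0 := by positivity
  simp only [one_pow, ne_eq, Nat.add_eq_zero_iff, one_ne_zero, and_false, not_false_eq_true,
    zero_pow, sub_zero, OfNat.ofNat_ne_zero]
  rw [show s + 1 + 1 = s + 2 by ring, show s + 2 + 1 = s + 3 by ring]
  field_simp
  ring

/-- Both forms are integrals of squares over `[0,1]`, and the integrands differ by the factor `(1 -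
α)² ≤ 1`. -/
theorem dotProduct_spectralHankel_le {L : ℕ} (v : Fin L → ℝ) :
    dotProduct v ((spectralHankel L).mulVec v)
      ≤ ∑ i, ∑ l, v i * v l / ((i : ℕ) + (l : ℕ) + 1) := by
  rw [← integral_sq_dotProduct_impulseResponse, ← integral_sq_sum_pow]
  refine intervalIntegral.integral_mono_on zero_le_one
    (Continuous.intervalIntegrable (by unfold dotProduct impulseResponse; fun_prop) _ _)
    (Continuous.intervalIntegrable (by fun_prop) _ _) fun α hα => ?_
  have : dotProduct v (impulseResponse L α) = (1 - α) * ∑ i, v i * α ^ (i : ℕ) := by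
    rw [dotProduct, Finset.mul_sum]
    exact Finset.sum_congr rfl fun i _ => by simp only [impulseResponse]; ring
  rw [this, mul_pow]
  refine mul_le_of_le_one_left (sq_nonneg _) ?_
  nlinarith [hα.1, hα.2]

/-- Schur test: `ab ≤ (a² + b²)/2` reduces the form to row sums, each at most the harmonic number of
`L`. -/
theorem hilbert_form_le {L : ℕ} (w : Fin L → ℝ) :
    ∑ i, ∑ l, w i * w l / ((i : ℕ) + (l : ℕ) + 1 : ℝ) ≤ (1 + Real.log L) * ∑ i, w i ^ 2 := by
  have hrow : ∀ i : Fin L, ∑ l : Fin L, 1 / ((i : ℕ) + (l : ℕ) + 1 : ℝ) ≤ 1 + Real.log L := by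
    intro i
    have h := harmonic_le_one_add_log L
    rw [harmonic] at h
    push_cast at h
    rw [← Fin.sum_univ_eq_sum_range fun l => ((l : ℝ) + 1)⁻¹] at h
    refine le_trans (Finset.sum_le_sum fun l _ => ?_) h
    rw [one_div]
    refine inv_anti₀ (by positivity) ?_
    have : (0 : ℝ) ≤ (i : ℕ) := by positivity
    linarith
  have hsym : ∑ i : Fin L, ∑ l : Fin L, w l ^ 2 / 2 * (1 / ((i : ℕ) + (l : ℕ) + 1 : ℝ))
      = ∑ i : Fin L, ∑ l : Fin L, w i ^ 2 / 2 * (1 / ((i : ℕ) + (l : ℕ) + 1 : ℝ)) := by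
    rw [Finset.sum_comm]
    exact Finset.sum_congr rfl fun i _ => Finset.sum_congr rfl fun l _ => by ring_nf
  calc ∑ i, ∑ l, w i * w l / ((i : ℕ) + (l : ℕ) + 1 : ℝ)
      ≤ ∑ i : Fin L, ∑ l : Fin L, (w i ^ 2 / 2 * (1 / ((i : ℕ) + (l : ℕ) + 1 : ℝ))
        + w l ^ 2 / 2 * (1 / ((i : ℕ) + (l : ℕ) + 1 : ℝ))) := by
        refine Finset.sum_le_sum fun i _ => Finset.sum_le_sum fun l _ => ?_
        rw [← add_mul, div_eq_mul_one_div]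
        refine mul_le_mul_of_nonneg_right ?_ (by positivity)
        nlinarith [sq_nonneg (w i - w l)]
    _ = ∑ i : Fin L, w i ^ 2 * ∑ l : Fin L, 1 / ((i : ℕ) + (l : ℕ) + 1 : ℝ) := by
        simp only [Finset.sum_add_distrib]
        rw [hsym, ← Finset.sum_add_distrib]
        refine Finset.sum_congr rfl fun i _ => ?_
        rw [← Finset.mul_sum]
        ring
    _ ≤ ∑ i : Fin L, w i ^ 2 * (1 + Real.log L) :=
        Finset.sum_le_sum fun i _ => mul_le_mul_of_nonneg_left (hrow i) (sq_nonneg _)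
    _ = (1 + Real.log L) * ∑ i, w i ^ 2 := by rw [← Finset.sum_mul, mul_comm]

/-- Eigenvalue decay of the spectral filtering matrix in terms of Blaschke products. -/
theorem eigenvalue_le_of_blaschke {L : ℕ} {V : Matrix (Fin L) (Fin L) ℝ} {σ : Fin L → ℝ}
    (hV : V * V.transpose = 1) (hσ : Antitone σ)
    (hZ : ∀ j, (spectralHankel L).mulVec (V j) = σ j • V j) (p : ℕ → ℝ) (hp : ∀ m, 0 < p m)
    (j : Fin L) {R : ℝ} (hR : ∀ i : Fin L, |blaschke p j ((i : ℕ) + 1 / 2)| ≤ R) :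
    σ j ≤ R ^ 2 * (1 + Real.log L) := by
  let g : ℕ → Fin L → ℝ := fun m i => blaschke p m ((i : ℕ) + 1 / 2) / ((i : ℕ) + 1 / 2 + p m)
  -- A kernel vector `c` of `B` holds the coordinates of a vector in the span of `V 0, …, V j` that
  -- is orthogonal to `g 0, …, g (j - 1)`. The zero row `j` reflects the one spare dimension and
  -- makes `B` singular; the identity rows below it remove the later coordinates.
  let B : Matrix (Fin L) (Fin L) ℝ := Matrix.of fun i l =>
    if i < j then dotProduct (g i) (V l) else if i = j then 0 else if i = l then 1 else 0
  obtain ⟨c, hc0, hc⟩ := Matrix.exists_mulVec_eq_zero_iff.2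
    (Matrix.det_eq_zero_of_row_eq_zero (A := B) j fun l => by simp [B])
  set v : Fin L → ℝ := V.transpose.mulVec c with hv
  have hVc : V.mulVec v = c := by rw [hv, Matrix.mulVec_mulVec, hV, Matrix.one_mulVec]
  have hvs : v = ∑ l, c l • V l := by
    rw [hv]; ext i
    simp [Matrix.mulVec, dotProduct, mul_comm]
  have hc_gt : ∀ i, j < i → c i = 0 := fun i hi => by
    have h := congrFun hc i
    simpa [B, Matrix.mulVec, dotProduct, not_lt.2 hi.le, hi.ne'] using h
  have hgv : ∀ m < (j : ℕ), dotProduct (g m) v = 0 := fun m hm => by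
    have h := congrFun hc ⟨m, hm.trans j.2⟩
    have hlt : (⟨m, hm.trans j.2⟩ : Fin L) < j := hm
    simp only [B, Matrix.mulVec, Matrix.of_apply, hlt, if_true, Pi.zero_apply] at h
    rw [hvs, dotProduct_sum, ← h, dotProduct]
    exact Finset.sum_congr rfl fun l _ => by rw [dotProduct_smul, smul_eq_mul, mul_comm]
  have hnorm : ∑ i, v i ^ 2 = ∑ l, c l ^ 2 := by
    have h1 : dotProduct v v = dotProduct c c := by
      conv_lhs => rw [hv, Matrix.mulVec_transpose, ← Matrix.dotProduct_mulVec, ← Matrix.mulVec_transpose, hVc]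
    simpa [dotProduct, sq] using h1
  have hform : dotProduct v ((spectralHankel L).mulVec v) = ∑ l, σ l * c l ^ 2 := by
    have h1 : (spectralHankel L).mulVec v = ∑ l, (c l * σ l) • V l := by
      rw [hvs, Matrix.mulVec_sum]
      exact Finset.sum_congr rfl fun l _ => by rw [Matrix.mulVec_smul, hZ, smul_smul]
    rw [h1, dotProduct_sum]
    refine Finset.sum_congr rfl fun l _ => ?_
    have : dotProduct v (V l) = c l := by
      rw [dotProduct_comm]; exact congrFun hVc l
    rw [dotProduct_smul, this, smul_eq_mul]; ring
  have hpos : 0 < ∑ l, c l ^ 2 := by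
    obtain ⟨l, hl⟩ := Function.ne_iff.1 hc0
    exact Finset.sum_pos' (fun _ _ => sq_nonneg _) ⟨l, Finset.mem_univ _, by
      have : c l ≠ 0 := hl
      positivity⟩
  have hlow : σ j * ∑ l, c l ^ 2 ≤ dotProduct v ((spectralHankel L).mulVec v) := by
    rw [hform, Finset.mul_sum]
    refine Finset.sum_le_sum fun l _ => ?_
    rcases lt_or_ge j l with h | h
    · simp [hc_gt l h]
    · exact mul_le_mul_of_nonneg_right (hσ h) (sq_nonneg _)
  let w : Fin L → ℝ := fun i => blaschke p j ((i : ℕ) + 1 / 2) * v i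
  -- Orthogonality to the `g m` annihilates the rank one kernels, leaving the Hilbert form of the
  -- damped vector `w`.
  have hsplit : ∑ i, ∑ l, v i * v l / ((i : ℕ) + (l : ℕ) + 1 : ℝ)
      = ∑ i, ∑ l, w i * w l / ((i : ℕ) + (l : ℕ) + 1 : ℝ) := by
    have h1 : ∀ i l : Fin L, v i * v l / ((i : ℕ) + (l : ℕ) + 1 : ℝ)
        = (∑ m ∈ Finset.range j, 2 * p m * ((g m i * v i) * (g m l * v l)))
          + w i * w l / ((i : ℕ) + (l : ℕ) + 1 : ℝ) := by
      intro i l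
      have h := cauchy_kernel_eq p hp j (x := ((i : ℕ) : ℝ) + 1 / 2) (y := ((l : ℕ) : ℝ) + 1 / 2)
        (by positivity) (by positivity)
      rw [show ((i : ℕ) : ℝ) + 1 / 2 + (((l : ℕ) : ℝ) + 1 / 2) = (i : ℕ) + (l : ℕ) + 1 by ring] at h
      rw [div_eq_mul_one_div, h, mul_add, Finset.mul_sum]
      congr 1
      · exact Finset.sum_congr rfl fun m _ => by simp only [g]; ring
      · simp only [w]; ring
    simp only [h1, Finset.sum_add_distrib]
    rw [add_eq_right]
    have h2 : ∀ i : Fin L, ∑ l : Fin L, ∑ m ∈ Finset.range j, 2 * p m * ((g m i * v i) * (g m l * v l))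
        = 0 := by
      intro i
      rw [Finset.sum_comm]
      refine Finset.sum_eq_zero fun m hm => ?_
      rw [← Finset.mul_sum, ← Finset.mul_sum]
      have : ∑ l, g m l * v l = 0 := hgv m (Finset.mem_range.1 hm)
      rw [this]; ring
    exact Finset.sum_eq_zero fun i _ => h2 i
  have hw : ∑ i, w i ^ 2 ≤ R ^ 2 * ∑ l, c l ^ 2 := by
    rw [← hnorm, Finset.mul_sum]
    refine Finset.sum_le_sum fun i _ => ?_
    simp only [w, mul_pow]
    exact mul_le_mul_of_nonneg_right (sq_le_sq' (abs_le.1 (hR i)).1 (abs_le.1 (hR i)).2)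
      (sq_nonneg _)
  have hlog : 0 ≤ Real.log L := Real.log_natCast_nonneg L
  have hfin := hlow.trans ((dotProduct_spectralHankel_le v).trans
    (hsplit.le.trans ((hilbert_form_le w).trans
      (mul_le_mul_of_nonneg_left hw (by positivity : 0 ≤ 1 + Real.log L)))))
  refine le_of_mul_le_mul_right (hfin.trans (le_of_eq ?_)) hpos
  ring

end

/-! ### From the mean of the tail energy to a pointwise bound. -/

noncomputable section

/-- The squared length of the part of `w` that is orthogonal to the first `k` rows of `V`. -/
def tailEnergy {L : ℕ} (V : Matrix (Fin L) (Fin L) ℝ) (k : ℕ) (w : Fin L → ℝ) : ℝ :=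
  ∑ j ∈ Finset.univ.filter (fun j : Fin L => k ≤ (j : ℕ)), dotProduct (V j) w ^ 2

theorem sum_dotProduct_sq_eq {L : ℕ} {V : Matrix (Fin L) (Fin L) ℝ} (hV : V * V.transpose = 1)
    (w : Fin L → ℝ) : ∑ j, dotProduct (V j) w ^ 2 = ∑ i, w i ^ 2 := by
  have hV' : V.transpose * V = 1 := mul_eq_one_comm.1 hV
  have h : dotProduct (V.mulVec w) (V.mulVec w) = dotProduct w w := by
    rw [Matrix.dotProduct_mulVec, Matrix.vecMul_mulVec, hV', Matrix.vecMul_one]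
  simpa [dotProduct, sq, Matrix.mulVec] using h

theorem tailEnergy_le {L : ℕ} {V : Matrix (Fin L) (Fin L) ℝ} (hV : V * V.transpose = 1) (k : ℕ)
    (w : Fin L → ℝ) : tailEnergy V k w ≤ ∑ i, w i ^ 2 := by
  rw [← sum_dotProduct_sq_eq hV]
  exact Finset.sum_le_sum_of_subset_of_nonneg (Finset.filter_subset _ _) fun _ _ _ => sq_nonneg _

theorem tailEnergy_nonneg {L : ℕ} (V : Matrix (Fin L) (Fin L) ℝ) (k : ℕ) (w : Fin L → ℝ) :
    0 ≤ tailEnergy V k w :=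
  Finset.sum_nonneg fun _ _ => sq_nonneg _

theorem tailEnergy_le_add_sub {L : ℕ} (V : Matrix (Fin L) (Fin L) ℝ) (k : ℕ) (w w' : Fin L → ℝ) :
    tailEnergy V k w ≤ 2 * tailEnergy V k w' + 2 * tailEnergy V k (w - w') := by
  unfold tailEnergy
  rw [Finset.mul_sum, Finset.mul_sum, ← Finset.sum_add_distrib]
  refine Finset.sum_le_sum fun j _ => ?_
  rw [dotProduct_sub]
  nlinarith [sq_nonneg (dotProduct (V j) w - 2 * dotProduct (V j) w')]

theorem sum_impulseResponse_sq_le (L : ℕ) {α : ℝ} (h0 : 0 ≤ α) (h1 : α ≤ 1) :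
    ∑ i, impulseResponse L α i ^ 2 ≤ 1 - α := by
  have hg : (1 - α) * ∑ i ∈ Finset.range L, α ^ i = 1 - α ^ L := mul_neg_geom_sum α L
  rw [← Fin.sum_univ_eq_sum_range] at hg
  calc ∑ i, impulseResponse L α i ^ 2
      ≤ ∑ i : Fin L, (1 - α) * ((1 - α) * α ^ (i : ℕ)) := by
        refine Finset.sum_le_sum fun i _ => ?_
        have hp : α ^ (i : ℕ) ≤ 1 := pow_le_one₀ h0 h1
        have hp0 : 0 ≤ α ^ (i : ℕ) := pow_nonneg h0 _
        simp only [impulseResponse]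
        nlinarith [mul_nonneg (sq_nonneg (1 - α)) (mul_nonneg hp0 (sub_nonneg.2 hp))]
    _ = (1 - α) * (1 - α ^ L) := by rw [← Finset.mul_sum, ← Finset.mul_sum, hg]
    _ ≤ 1 - α := mul_le_of_le_one_right (by linarith) (by linarith [pow_nonneg h0 L])

/-- The impulse response is Hölder continuous of exponent `1 / 2`, uniformly in the length. -/
theorem sum_impulseResponse_sub_sq_le (L : ℕ) {α β : ℝ} (hα : α ∈ Set.Icc (0 : ℝ) 1)
    (hβ : β ∈ Set.Icc (0 : ℝ) 1) :
    ∑ i, (impulseResponse L α - impulseResponse L β) i ^ 2 ≤ 2 * |α - β| := by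
  wlog hab : α ≤ β generalizing α β
  · rw [abs_sub_comm]
    refine le_of_eq_of_le (Finset.sum_congr rfl fun i _ => ?_) (this hβ hα (le_of_not_ge hab))
    simp only [Pi.sub_apply]; ring
  rw [abs_of_nonpos (by linarith)]
  obtain ⟨hα0, hα1⟩ := hα
  obtain ⟨hβ0, hβ1⟩ := hβ
  -- At `β = 1` the geometric series diverges, but there the response vanishes. Otherwise the sum is
  -- bounded by its infinite extension, which has a closed form.
  rcases hβ1.eq_or_lt with rfl | hβ1
  · have h := sum_impulseResponse_sq_le L hα0 hα1
    have : impulseResponse L 1 = 0 := by ext i; simp [impulseResponse]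
    rw [this, sub_zero]
    linarith
  · have hα1 : α < 1 := hab.trans_lt hβ1
    have s1 := (hasSum_geometric_of_lt_one (sq_nonneg α) (by nlinarith)).mul_left ((1 - α) ^ 2)
    have s2 := (hasSum_geometric_of_lt_one (mul_nonneg hα0 hβ0) (by nlinarith)).mul_left
      (2 * (1 - α) * (1 - β))
    have s3 := (hasSum_geometric_of_lt_one (sq_nonneg β) (by nlinarith)).mul_left ((1 - β) ^ 2)
    have s := (s1.sub s2).add s3
    have hle := sum_le_hasSum (Finset.range L) (fun i _ => ?_) s
    · rw [← Fin.sum_univ_eq_sum_range (fun i => (1 - α) ^ 2 * (α ^ 2) ^ i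
        - 2 * (1 - α) * (1 - β) * (α * β) ^ i + (1 - β) ^ 2 * (β ^ 2) ^ i)] at hle
      have e1 : 0 < 1 - α * β := by nlinarith
      have e2 : 0 < 1 - α := by linarith
      have e3 : 0 < 1 - β := by linarith
      have hval : (1 - α) ^ 2 * (1 - α ^ 2)⁻¹ - 2 * (1 - α) * (1 - β) * (1 - α * β)⁻¹
          + (1 - β) ^ 2 * (1 - β ^ 2)⁻¹
          = 2 * (α - β) ^ 2 / ((1 + α) * (1 + β) * (1 - α * β)) := by
        rw [show 1 - α ^ 2 = (1 - α) * (1 + α) by ring, show 1 - β ^ 2 = (1 - β) * (1 + β) by ring]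
        have := e1.ne'
        have := e2.ne'
        have := e3.ne'
        have : 1 + α ≠ 0 := by positivity
        have : 1 + β ≠ 0 := by positivity
        field_simp
        ring
      rw [hval] at hle
      refine le_trans (le_of_eq_of_le (Finset.sum_congr rfl fun i _ => ?_) hle) ?_
      · simp only [impulseResponse, Pi.sub_apply]
        ring
      · rw [div_le_iff₀ (by positivity)]
        have f1 : β - α ≤ 1 - α * β := by nlinarith
        have f2 : 1 ≤ (1 + α) * (1 + β) := by nlinarith [mul_nonneg hα0 hβ0]
        have f3 : β - α ≤ (1 + α) * (1 + β) * (1 - α * β) := by nlinarith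
        nlinarith [mul_le_mul_of_nonneg_left f3 (sub_nonneg.2 hab)]
    · have : (1 - α) ^ 2 * (α ^ 2) ^ i - 2 * (1 - α) * (1 - β) * (α * β) ^ i
          + (1 - β) ^ 2 * (β ^ 2) ^ i = ((1 - α) * α ^ i - (1 - β) * β ^ i) ^ 2 := by ring
      rw [this]
      exact sq_nonneg _

theorem continuous_tailEnergy_impulseResponse {L : ℕ} (V : Matrix (Fin L) (Fin L) ℝ) (k : ℕ) :
    Continuous fun α => tailEnergy V k (impulseResponse L α) := by
  unfold tailEnergy dotProduct impulseResponse
  fun_prop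

theorem integral_tailEnergy {L : ℕ} {V : Matrix (Fin L) (Fin L) ℝ} {σ : Fin L → ℝ}
    (hV : V * V.transpose = 1) (hZ : ∀ j, (spectralHankel L).mulVec (V j) = σ j • V j) (k : ℕ) :
    ∫ α in (0 : ℝ)..1, tailEnergy V k (impulseResponse L α)
      = ∑ j ∈ Finset.univ.filter (fun j : Fin L => k ≤ (j : ℕ)), σ j := by
  unfold tailEnergy
  rw [intervalIntegral.integral_finsetSum fun i _ => Continuous.intervalIntegrable
    (by unfold dotProduct impulseResponse; fun_prop) _ _]
  refine Finset.sum_congr rfl fun j _ => ?_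
  have h1 : dotProduct (V j) (V j) = 1 := by
    have := congrFun (congrFun hV j) j
    simpa [Matrix.mul_apply, dotProduct] using this
  rw [integral_sq_dotProduct_impulseResponse, hZ, dotProduct_smul, h1, smul_eq_mul, mul_one]

/-- The pointwise tail energy is controlled by its mean. -/
theorem tailEnergy_sq_le_integral {L : ℕ} {V : Matrix (Fin L) (Fin L) ℝ}
    (hV : V * V.transpose = 1) (k : ℕ) {α : ℝ} (hα : α ∈ Set.Icc (0 : ℝ) 1) :
    tailEnergy V k (impulseResponse L α) ^ 2
      ≤ 32 * ∫ β in (0 : ℝ)..1, tailEnergy V k (impulseResponse L β) := by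
  set q : ℝ → ℝ := fun β => tailEnergy V k (impulseResponse L β) with hq
  have hq0 : ∀ β, 0 ≤ q β := fun β => tailEnergy_nonneg _ _ _
  have hqc : Continuous q := continuous_tailEnergy_impulseResponse V k
  have hq1 : q α ≤ 1 := (tailEnergy_le hV k _).trans
    ((sum_impulseResponse_sq_le L hα.1 hα.2).trans (by linarith [hα.1]))
  change q α ^ 2 ≤ 32 * ∫ β in (0 : ℝ)..1, q β
  set d := q α / 8 with hd
  have hd0 : 0 ≤ d := div_nonneg (hq0 α) (by norm_num)
  have hd1 : d ≤ 1 := by linarith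
  -- The interval `[a, a + d]` contains `α` and stays in `[0,1]`, even for `α` near an endpoint. On
  -- it `q β ≥ q α / 2 - 2d = 2d`, so the integral of `q` is at least `2d² = (q α)² / 32`.
  set a := α * (1 - d) with ha
  have ha0 : 0 ≤ a := mul_nonneg hα.1 (by linarith)
  have haα : a ≤ α := mul_le_of_le_one_right hα.1 (by linarith)
  have hαd : α ≤ a + d := by nlinarith [hα.1, hα.2]
  have had : a + d ≤ 1 := by nlinarith [hα.1, hα.2]
  have hpt : ∀ β ∈ Set.Icc a (a + d), q α ≤ 2 * q β + 4 * d := by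
    intro β hβ
    have h1 := tailEnergy_le_add_sub V k (impulseResponse L α) (impulseResponse L β)
    have h2 := (tailEnergy_le hV k (impulseResponse L α - impulseResponse L β)).trans
      (sum_impulseResponse_sub_sq_le L hα ⟨ha0.trans hβ.1, hβ.2.trans had⟩)
    have h3 : |α - β| ≤ d := by
      rw [abs_le]
      constructor <;> linarith [hβ.1, hβ.2]
    simp only [hq]
    linarith
  have hint := intervalIntegral.integral_mono_on (by linarith : a ≤ a + d)
    (Continuous.intervalIntegrable (by fun_prop) _ _)
    (Continuous.intervalIntegrable (by fun_prop) _ _) hpt (μ := volume)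
  rw [intervalIntegral.integral_add (Continuous.intervalIntegrable (by fun_prop) _ _)
    (Continuous.intervalIntegrable (by fun_prop) _ _), intervalIntegral.integral_const_mul,
    intervalIntegral.integral_const, intervalIntegral.integral_const] at hint
  have hsub : ∫ β in a..(a + d), q β ≤ ∫ β in (0 : ℝ)..1, q β :=
    intervalIntegral.integral_mono_interval ha0 (by linarith) had
      (Filter.Eventually.of_forall hq0) (hqc.intervalIntegrable _ _)
  simp only [add_sub_cancel_left, smul_eq_mul] at hint
  have : q α = 8 * d := by rw [hd]; ring
  rw [this] at hint ⊢
  nlinarith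

theorem log_grid_le {L : ℕ} (hL : 8192 ≤ L) : ((Nat.log 2 L + 5 : ℕ) : ℝ) ≤ 2 * Real.log L := by
  have h2 := Real.log_two_gt_d9
  have hlog : (Nat.log 2 L : ℝ) * Real.log 2 ≤ Real.log L := by
    rw [← Real.log_pow]
    refine Real.log_le_log (by positivity) ?_
    exact_mod_cast Nat.pow_log_le_self 2 (by omega : L ≠ 0)
  have h13 : (13 : ℝ) * Real.log 2 ≤ Real.log L := by
    have : (13 : ℝ) * Real.log 2 = Real.log (2 ^ 13) := by rw [Real.log_pow]; norm_num
    rw [this]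
    refine Real.log_le_log (by positivity) ?_
    norm_num
    exact_mod_cast hL
  -- The surplus `(2 - 1 / log 2) log L` exceeds `5` once `L ≥ 2^13 = 8192`.
  push_cast
  have hn : (0 : ℝ) ≤ Nat.log 2 L := by positivity
  nlinarith

/-- Exponential decay of the eigenvalues of the spectral filtering matrix. -/
theorem eigenvalue_le_exp {L : ℕ} (hL : 8192 ≤ L) {V : Matrix (Fin L) (Fin L) ℝ} {σ : Fin L → ℝ}
    (hV : V * V.transpose = 1) (hσ : Antitone σ)
    (hZ : ∀ j, (spectralHankel L).mulVec (V j) = σ j • V j) (j : Fin L) :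
    σ j ≤ Real.exp 8 * (1 + Real.log L) * Real.exp (-(4 / Real.log L)) ^ (j : ℕ) := by
  have hlog : 0 < Real.log L := Real.log_pos (by exact_mod_cast (by omega : 1 < L))
  have h := eigenvalue_le_of_blaschke hV hσ hZ _ (dyadicNode_pos (Nat.log 2 L + 5)) j
    fun i => abs_blaschke_dyadic_le L i j i.2
  refine h.trans ?_
  have hN := log_grid_le hL
  set N := Nat.log 2 L + 5
  -- Rounding down costs at most one period, which is the source of the factor `exp 8` in the
  -- squared bound.
  have hdiv : (j : ℕ) / (2 * Real.log L) - 1 ≤ (((j : ℕ) / N : ℕ) : ℝ) := by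
    have hN0 : (0 : ℝ) < N := by positivity
    have h1 : ((j : ℕ) : ℝ) / (2 * Real.log L) ≤ (j : ℕ) / N :=
      div_le_div_of_nonneg_left (by positivity) hN0 hN
    have h2 := Nat.lt_floor_add_one (((j : ℕ) : ℝ) / (N : ℝ))
    rw [Nat.floor_div_eq_div] at h2
    linarith
  have hexp : (Real.exp (-4) ^ ((j : ℕ) / N)) ^ 2
      ≤ Real.exp 8 * Real.exp (-(4 / Real.log L)) ^ (j : ℕ) := by
    rw [← Real.exp_nat_mul, ← Real.exp_nat_mul, ← Real.exp_nat_mul, ← Real.exp_add]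
    refine Real.exp_le_exp.2 ?_
    have : ((j : ℕ) : ℝ) * -(4 / Real.log L) = -8 * ((j : ℕ) / (2 * Real.log L)) := by
      field_simp
      ring
    rw [this]
    push_cast
    linarith
  calc _ ≤ Real.exp 8 * Real.exp (-(4 / Real.log L)) ^ (j : ℕ) * (1 + Real.log L) :=
        mul_le_mul_of_nonneg_right hexp (by positivity)
    _ = _ := by ring

/-- From `exp(4/ℓ) ≥ 1 + 4/ℓ` follows `1 / (1 - ρ) ≤ 1 + ℓ/4` for the ratio `ρ = exp(-4/ℓ)`. -/
theorem sum_tail_geometric_le (L k : ℕ) {ℓ : ℝ} (hℓ : 0 < ℓ) :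
    ∑ j ∈ Finset.univ.filter (fun j : Fin L => k ≤ (j : ℕ)), Real.exp (-(4 / ℓ)) ^ (j : ℕ)
      ≤ (1 + ℓ / 4) * Real.exp (-(2 * (k / ℓ))) ^ 2 := by
  set ρ := Real.exp (-(4 / ℓ)) with hρ
  have hρ1 : ρ * (1 + 4 / ℓ) ≤ 1 := by
    have h := Real.add_one_le_exp (4 / ℓ)
    have h2 : ρ * Real.exp (4 / ℓ) = 1 := by rw [hρ, ← Real.exp_add]; simp
    nlinarith [Real.exp_pos (-(4 / ℓ))]
  have hρ0 : 0 < ρ := Real.exp_pos _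
  have hlt : ρ < 1 := by
    have : 0 < ρ * (4 / ℓ) := by positivity
    linarith
  have hsum : ∑ j ∈ Finset.univ.filter (fun j : Fin L => k ≤ (j : ℕ)), ρ ^ (j : ℕ) = ∑ j ∈ Finset.Ico k L, ρ ^ j := by
    refine Finset.sum_bij (fun j _ => (j : ℕ)) (fun j hj => ?_) (fun a _ b _ h => Fin.ext h)
      (fun b hb => ?_) fun _ _ => rfl
    · simpa using hj
    · obtain ⟨h1, h2⟩ := Finset.mem_Ico.1 hb
      exact ⟨⟨b, h2⟩, by simpa using h1, rfl⟩
  rw [hsum]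
  refine (geom_sum_Ico_le_of_lt_one hρ0.le hlt).trans ?_
  have hk : ρ ^ k = Real.exp (-(2 * (k / ℓ))) ^ 2 := by
    rw [hρ, ← Real.exp_nat_mul, ← Real.exp_nat_mul]
    congr 1
    push_cast
    ring
  rw [hk, div_le_iff₀ (by linarith)]
  have h3 : 1 ≤ (1 + ℓ / 4) * (1 - ρ) := by
    have : (1 + ℓ / 4) * (1 - ρ) = (1 - ρ * (1 + 4 / ℓ)) * (ℓ / 4) + 1 := by
      field_simp
      ring
    rw [this]
    have : 0 ≤ (1 - ρ * (1 + 4 / ℓ)) * (ℓ / 4) := mul_nonneg (by linarith) (by positivity)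
    linarith
  nlinarith [sq_nonneg (Real.exp (-(2 * (k / ℓ))))]

/-- The spectral filters approximate every impulse response exponentially well. -/
theorem exists_tailEnergy_impulseResponse_le :
    ∃ C : ℝ, 0 < C ∧ ∀ (L k h : ℕ), 2 ≤ L → k ≤ L → k ≤ h → 1 ≤ h →
      ∀ (V : Matrix (Fin L) (Fin L) ℝ) (σ : Fin L → ℝ), V * V.transpose = 1 → Antitone σ →
      (∀ j, (spectralHankel L).mulVec (V j) = σ j • V j) →
      ∀ α ∈ Set.Icc (0 : ℝ) 1, tailEnergy V k (impulseResponse L α)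
        ≤ C * h * Real.exp (-(2 * (k / Real.log L))) := by
  refine ⟨Real.exp (16384 / Real.log 2) + 12 * Real.exp 4, by positivity, ?_⟩
  intro L k h hL hkL hkh hh V σ hV hσ hZ α hα
  have hlog2 : 0 < Real.log 2 := Real.log_pos (by norm_num)
  have hlogL : Real.log 2 ≤ Real.log L :=
    Real.log_le_log (by norm_num) (by exact_mod_cast hL)
  have hlog : 0 < Real.log L := hlog2.trans_le hlogL
  have hh' : (1 : ℝ) ≤ h := by exact_mod_cast hh
  have hQ1 : tailEnergy V k (impulseResponse L α) ≤ 1 := (tailEnergy_le hV k _).trans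
    ((sum_impulseResponse_sq_le L hα.1 hα.2).trans (by linarith [hα.1]))
  -- While the exponent stays bounded, the trivial estimate `Q ≤ 1` is enough. This covers `L <
  -- 8192`, where `k ≤ 8192` and `16384 = 2 · 8192`, and also `k < log L`.
  have htriv : 2 * (k / Real.log L) ≤ 16384 / Real.log 2 →
      tailEnergy V k (impulseResponse L α)
        ≤ (Real.exp (16384 / Real.log 2) + 12 * Real.exp 4) * h
          * Real.exp (-(2 * (k / Real.log L))) := by
    intro hle
    refine hQ1.trans ?_
    have h1 : 1 ≤ Real.exp (16384 / Real.log 2) * Real.exp (-(2 * (k / Real.log L))) := by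
      rw [← Real.exp_add]
      exact Real.one_le_exp (by linarith)
    have h2 : Real.exp (16384 / Real.log 2)
        ≤ (Real.exp (16384 / Real.log 2) + 12 * Real.exp 4) * h := by
      nlinarith [Real.exp_pos (16384 / Real.log 2), Real.exp_pos 4]
    exact h1.trans (mul_le_mul_of_nonneg_right h2 (Real.exp_pos _).le)
  rcases lt_or_ge L 8192 with hLs | hLb
  · refine htriv ?_
    have hk : (k : ℝ) ≤ 8192 := by exact_mod_cast (by omega : k ≤ 8192)
    have : (k : ℝ) / Real.log L ≤ 8192 / Real.log 2 :=
      div_le_div₀ (by norm_num) hk hlog2 hlogL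
    calc 2 * (k / Real.log L) ≤ 2 * (8192 / Real.log 2) := by linarith
      _ = 16384 / Real.log 2 := by ring
  rcases lt_or_ge (k : ℝ) (Real.log L) with hks | hkb
  · refine htriv ?_
    have h1 : (k : ℝ) / Real.log L ≤ 1 := (div_le_one hlog).2 hks.le
    have h2 : (2 : ℝ) ≤ 16384 / Real.log 2 := by
      rw [le_div_iff₀ hlog2]
      linarith [Real.log_two_lt_d9]
    linarith
  set E := Real.exp (-(2 * (k / Real.log L))) with hE
  have hE0 : 0 < E := Real.exp_pos _
  have hkh' : (k : ℝ) ≤ h := by exact_mod_cast hkh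
  have hτ : ∑ j ∈ Finset.univ.filter (fun j : Fin L => k ≤ (j : ℕ)), σ j
      ≤ Real.exp 8 * (1 + Real.log L) * ((1 + Real.log L / 4) * E ^ 2) := by
    refine le_trans (Finset.sum_le_sum fun j _ => eigenvalue_le_exp hLb hV hσ hZ j) ?_
    rw [← Finset.mul_sum]
    exact mul_le_mul_of_nonneg_left (sum_tail_geometric_le L k hlog) (by positivity)
  have hsq := tailEnergy_sq_le_integral hV k hα
  rw [integral_tailEnergy hV hZ] at hsq
  have he : Real.exp 8 = Real.exp 4 ^ 2 := by rw [← Real.exp_nat_mul]; norm_num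
  have hfin : tailEnergy V k (impulseResponse L α) ≤ 12 * Real.exp 4 * h * E := by
    refine (abs_le_of_sq_le_sq' (hsq.trans ?_) (by positivity)).2
    -- Here `log L ≤ k ≤ h` and `1 ≤ h`, so both logarithmic factors are at most `2h`. The constant
    -- works because `32 · 4 ≤ 12²`.
    have hb : (1 + Real.log L) * (1 + Real.log L / 4) ≤ 2 * h * (2 * h) :=
      mul_le_mul (by linarith) (by linarith) (by positivity) (by positivity)
    calc _ ≤ 32 * (Real.exp 8 * (1 + Real.log L) * ((1 + Real.log L / 4) * E ^ 2)) := by linarith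
      _ = 32 * (Real.exp 4 ^ 2 * E ^ 2) * ((1 + Real.log L) * (1 + Real.log L / 4)) := by
          rw [he]; ring
      _ ≤ 32 * (Real.exp 4 ^ 2 * E ^ 2) * (2 * h * (2 * h)) :=
          mul_le_mul_of_nonneg_left hb (by positivity)
      _ ≤ (12 * Real.exp 4 * h * E) ^ 2 := by
          have : 0 ≤ Real.exp 4 ^ 2 * E ^ 2 * (h : ℝ) ^ 2 := by positivity
          nlinarith
  refine hfin.trans ?_
  have : 0 ≤ Real.exp (16384 / Real.log 2) * h * E := by positivity
  nlinarith

end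

/-! ### White inputs: the fit is an orthogonal projection. -/

theorem integral_dotProduct_sq_of_white {L : ℕ} {ν : Measure (Fin L → ℝ)}
    (hν : ∀ i, MemLp (fun u : Fin L → ℝ => u i) 2 ν) {s : ℝ}
    (hs : ∀ i j, ∫ u, u i * u j ∂ν = if i = j then s else 0) (w : Fin L → ℝ) :
    ∫ u, dotProduct w u ^ 2 ∂ν = s * dotProduct w w := by
  have hint : ∀ i j : Fin L, Integrable (fun u : Fin L → ℝ => w i * w j * (u i * u j)) ν :=
    fun i j => ((hν i).integrable_mul (hν j)).const_mul _
  have : ∀ u : Fin L → ℝ, dotProduct w u ^ 2 = ∑ i, ∑ j, w i * w j * (u i * u j) := fun u => by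
    rw [sq, dotProduct, Finset.sum_mul_sum]
    exact Finset.sum_congr rfl fun i _ => Finset.sum_congr rfl fun l _ => by ring
  simp only [this]
  rw [integral_finsetSum _ fun i _ => integrable_finsetSum _ fun j _ => hint i j, dotProduct,
    Finset.mul_sum]
  refine Finset.sum_congr rfl fun i _ => ?_
  rw [integral_finsetSum _ fun j _ => hint i j]
  simp only [integral_const_mul, hs]
  simp
  ring

/-- Whiteness turns the loss into `s` times the squared length of `Φᵀ m - μ(α)`. Pythagoras splits
this into a part inside the row space of `Φ`, the only one depending on `m`, and the residual. -/
theorem fitLoss_eq {L k : ℕ} {ν : Measure (Fin L → ℝ)}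
    (hν : ∀ i, MemLp (fun u : Fin L → ℝ => u i) 2 ν) {s : ℝ}
    (hs : ∀ i j, ∫ u, u i * u j ∂ν = if i = j then s else 0) {Φ : Matrix (Fin k) (Fin L) ℝ}
    (hΦ : Φ * Φ.transpose = 1) (α : ℝ) (m : Fin k → ℝ) :
    fitLoss ν Φ α m = s * (dotProduct (m - Φ.mulVec (impulseResponse L α))
        (m - Φ.mulVec (impulseResponse L α))
      + dotProduct (impulseResponse L α - Φ.transpose.mulVec (Φ.mulVec (impulseResponse L α)))
        (impulseResponse L α - Φ.transpose.mulVec (Φ.mulVec (impulseResponse L α)))) := by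
  set w := impulseResponse L α with hw
  set d := m - Φ.mulVec w with hd
  set r := w - Φ.transpose.mulVec (Φ.mulVec w) with hr
  have h1 : ∀ u, |dotProduct m (Φ.mulVec u) - dotProduct w u| ^ 2
      = dotProduct (Φ.transpose.mulVec d - r) u ^ 2 := by
    intro u
    rw [sq_abs]
    congr 1
    rw [Matrix.dotProduct_mulVec, ← Matrix.mulVec_transpose, ← sub_dotProduct]
    congr 1
    rw [hd, hr, Matrix.mulVec_sub]
    abel
  have hΦr : Φ.mulVec r = 0 := by
    rw [hr, Matrix.mulVec_sub, Matrix.mulVec_mulVec, hΦ, Matrix.one_mulVec, sub_self]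
  have h2 : dotProduct (Φ.transpose.mulVec d) r = 0 := by
    rw [Matrix.mulVec_transpose, ← Matrix.dotProduct_mulVec, hΦr, dotProduct_zero]
  have h3 : dotProduct (Φ.transpose.mulVec d) (Φ.transpose.mulVec d) = dotProduct d d := by
    conv_lhs => rw [Matrix.mulVec_transpose, ← Matrix.dotProduct_mulVec, ← Matrix.mulVec_transpose,
      Matrix.mulVec_mulVec, hΦ, Matrix.one_mulVec]
  clear_value r
  unfold fitLoss
  simp only [← hw, h1]
  rw [integral_dotProduct_sq_of_white hν hs, sub_dotProduct, dotProduct_sub, dotProduct_sub, h2,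
    dotProduct_comm r, h2, h3]
  ring

/-- For white inputs and orthonormal filters the spectral representation is the projection. -/
theorem isSpectralRepresentation_iff {L k : ℕ} {ν : Measure (Fin L → ℝ)} (hν : IsWhite ν)
    {Φ : Matrix (Fin k) (Fin L) ℝ} (hΦ : Φ * Φ.transpose = 1) (α : ℝ) (m : Fin k → ℝ) :
    IsSpectralRepresentation ν Φ α m ↔ m = Φ.mulVec (impulseResponse L α) := by
  obtain ⟨hν, s, hs0, hs⟩ := hν
  have hnn : ∀ d : Fin k → ℝ, 0 ≤ dotProduct d d := fun d =>
    Finset.sum_nonneg fun i _ => mul_self_nonneg _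
  constructor
  · intro h
    have h1 := h (Φ.mulVec (impulseResponse L α))
    rw [fitLoss_eq hν hs hΦ, fitLoss_eq hν hs hΦ, mul_le_mul_iff_right₀ hs0, sub_self,
      dotProduct_zero] at h1
    have h2 := hnn (m - Φ.mulVec (impulseResponse L α))
    exact sub_eq_zero.1 (dotProduct_self_eq_zero.1 (le_antisymm (by linarith) h2))
  · rintro rfl m'
    rw [fitLoss_eq hν hs hΦ, fitLoss_eq hν hs hΦ, mul_le_mul_iff_right₀ hs0, sub_self,
      dotProduct_zero]
    linarith [hnn (m' - Φ.mulVec (impulseResponse L α))]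

theorem mul_transpose_of_rows {L k : ℕ} {V : Matrix (Fin L) (Fin L) ℝ}
    (hV : V * V.transpose = 1) (hk : k ≤ L) {Φ : Matrix (Fin k) (Fin L) ℝ}
    (hΦ : ∀ j, Φ j = V (Fin.castLE hk j)) : Φ * Φ.transpose = 1 := by
  ext i j
  have h := congrFun (congrFun hV (Fin.castLE hk i)) (Fin.castLE hk j)
  simp only [Matrix.mul_apply, Matrix.transpose_apply] at h ⊢
  rw [hΦ, hΦ, h, Matrix.one_apply, Matrix.one_apply]
  simp

theorem sum_residual_sq_eq {L k : ℕ} {V : Matrix (Fin L) (Fin L) ℝ}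
    (hV : V * V.transpose = 1) (hk : k ≤ L) {Φ : Matrix (Fin k) (Fin L) ℝ}
    (hΦ : ∀ j, Φ j = V (Fin.castLE hk j)) (w : Fin L → ℝ) :
    ∑ l, (w - Φ.transpose.mulVec (Φ.mulVec w)) l ^ 2 = tailEnergy V k w := by
  have hΦ1 := mul_transpose_of_rows hV hk hΦ
  rw [← sum_dotProduct_sq_eq hV, tailEnergy, Finset.sum_filter]
  refine Finset.sum_congr rfl fun j _ => ?_
  split_ifs with h
  · have h0 : dotProduct (V j) (Φ.transpose.mulVec (Φ.mulVec w)) = 0 := by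
      rw [Matrix.dotProduct_mulVec]
      have : Matrix.vecMul (V j) Φ.transpose = 0 := by
        ext i
        have hij := congrFun (congrFun hV j) (Fin.castLE hk i)
        have hne : j ≠ Fin.castLE hk i := fun he => by
          have := congrArg Fin.val he
          simp at this
          omega
        rw [Matrix.one_apply_ne hne] at hij
        simp only [Matrix.vecMul, dotProduct, Matrix.transpose_apply, hΦ, Pi.zero_apply]
        simpa [Matrix.mul_apply] using hij
      rw [this, zero_dotProduct]
    rw [dotProduct_sub, h0, sub_zero]
  · have hr : Φ.mulVec (w - Φ.transpose.mulVec (Φ.mulVec w)) = 0 := by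
      rw [Matrix.mulVec_sub, Matrix.mulVec_mulVec, hΦ1, Matrix.one_mulVec, sub_self]
    have hΦj : Φ ⟨j, not_le.1 h⟩ = V j := hΦ _
    have hj : dotProduct (V j) (w - Φ.transpose.mulVec (Φ.mulVec w)) = 0 := by
      rw [← hΦj]
      exact congrFun hr ⟨j, not_le.1 h⟩
    rw [hj]
    norm_num

/-- A nonzero linear functional of the impulse response has countably many zeros. -/
theorem countable_zeros_dotProduct_impulseResponse {L : ℕ} {w : Fin L → ℝ} (hw : w ≠ 0) :
    {x : ℝ | dotProduct w (impulseResponse L x) = 0}.Countable := by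
  let p : Polynomial ℝ := ∑ i : Fin L, Polynomial.monomial (i : ℕ) (w i)
  have hp : p ≠ 0 := by
    intro h0
    refine hw (funext fun i => ?_)
    have h := congrArg (fun q => Polynomial.coeff q (i : ℕ)) h0
    simpa [p, Polynomial.finsetSum_coeff, Polynomial.coeff_monomial, Fin.val_inj] using h
  refine Set.Countable.mono ?_ ((p.roots.toFinset.finite_toSet.union (Set.finite_singleton 1)).countable)
  intro x hx
  have he : dotProduct w (impulseResponse L x) = (1 - x) * p.eval x := by
    simp only [p, Polynomial.eval_finsetSum, Polynomial.eval_monomial, dotProduct,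
      impulseResponse, Finset.mul_sum]
    exact Finset.sum_congr rfl fun i _ => by ring
  have hx' : (1 - x) * p.eval x = 0 := by rw [← he]; exact hx
  rcases mul_eq_zero.1 hx' with h | h
  · right
    simp only [Set.mem_singleton_iff]
    linarith
  · left
    simpa [hp] using h

/-! ### The main theorem. -/

theorem theorem1 :
    ∃ c : ℝ, 0 < c ∧
      ∀ (L k h : ℕ), 2 ≤ L → k ≤ h →
      ∀ (Φ : Matrix (Fin k) (Fin L) ℝ), IsSpectralFilters L k Φ →
      ∀ (ν : Measure (Fin L → ℝ)), IsProbabilityMeasure ν → IsWhite ν →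
      ∀ (Ω : Type*) [MeasurableSpace Ω] (P : Measure Ω), IsProbabilityMeasure P →
      ∀ (α : Fin h → Ω → ℝ), (∀ i, Measurable (α i)) → iIndepFun α P →
        (∀ i, ∀ᵐ ω ∂P, α i ω ∈ Set.Icc (0 : ℝ) 1) →
        (∀ i (x : ℝ), P {ω | α i ω = x} = 0) →
      ∀ᵐ ω ∂P,
        ∃ (M : Matrix (Fin h) (Fin k) ℝ) (Mt : Matrix (Fin k) (Fin h) ℝ),
          IsAlgorithmRun ν Φ (fun i => α i ω) M Mt ∧
          (∀ M' Mt', IsAlgorithmRun ν Φ (fun i => α i ω) M' Mt' → M' = M ∧ Mt' = Mt) ∧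
          Mt * M = 1 ∧
          frobNorm (Φ - Mt * impulseMatrix L (fun i => α i ω)) ≤
            c * maxSingularValue Mt * (h : ℝ) * Real.exp (-((k : ℝ) / Real.log (L : ℝ))) := by
  obtain ⟨C, hC, hbound⟩ := exists_tailEnergy_impulseResponse_le
  refine ⟨Real.sqrt C, Real.sqrt_pos.2 hC, ?_⟩
  intro L k h hL hkh Φ hΦ ν _ hν Ω _ P _ α hmeas hind hIcc hatom
  obtain ⟨V, σ, hV, hσ, hZ, hk, hrows⟩ := hΦ
  have hΦ1 := mul_transpose_of_rows hV hk hrows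
  -- The first `k` samples already give a nonsingular square block of `M`, which forces full column
  -- rank.
  have hdet := ae_det_ne_zero_of_iIndepFun (P := P)
    (fun j x => dotProduct (Φ j) (impulseResponse L x))
    (fun j => by unfold dotProduct impulseResponse; fun_prop)
    (fun c hc => by
      have hw : Matrix.vecMul c Φ ≠ 0 := fun h0 => hc (by
        have := congrArg (fun y => Matrix.vecMul y Φ.transpose) h0
        simpa [Matrix.vecMul_vecMul, hΦ1] using this)
      refine (countable_zeros_dotProduct_impulseResponse hw).mono fun x hx => ?_
      change dotProduct (Matrix.vecMul c Φ) _ = 0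
      rw [← Matrix.dotProduct_mulVec]
      exact hx)
    (fun i => α (Fin.castLE hkh i)) (fun i => hmeas _)
    (hind.precomp (Fin.castLE_injective hkh)) (fun i x => hatom _ x)
  filter_upwards [hdet, ae_all_iff.2 hIcc] with ω hω hα
  set A := impulseMatrix L fun i => α i ω with hA
  set M : Matrix (Fin h) (Fin k) ℝ := fun i => Φ.mulVec (impulseResponse L (α i ω)) with hM
  have hinj : ∀ v, M.mulVec v = 0 → v = 0 := by
    intro v hv
    by_contra hv0
    refine hω (Matrix.exists_mulVec_eq_zero_iff.1 ⟨v, hv0, ?_⟩)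
    ext i
    exact congrFun hv (Fin.castLE hkh i)
  obtain ⟨Mt, hMP, hMtM⟩ := exists_isMoorePenroseInverse_of_injective M hinj
  refine ⟨M, Mt, ⟨fun i => (isSpectralRepresentation_iff hν hΦ1 _ _).2 rfl, hMP⟩, ?_, hMtM, ?_⟩
  · rintro M' Mt' ⟨hr, hp⟩
    have hM' : M' = M := funext fun i => (isSpectralRepresentation_iff hν hΦ1 _ _).1 (hr i)
    subst hM'
    exact ⟨rfl, hp.unique hMP⟩
  · have hfac : Mt * A - Φ = Mt * (A - M * Φ) := by
      rw [Matrix.mul_sub, ← Matrix.mul_assoc, hMtM, Matrix.one_mul]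
    rw [frobNorm_sub_comm, hfac]
    refine (frobNorm_mul_le _ _).trans ?_
    have hE : Real.exp (-(2 * ((k : ℝ) / Real.log L))) = Real.exp (-((k : ℝ) / Real.log L)) ^ 2 := by
      rw [← Real.exp_nat_mul]
      congr 1
      push_cast
      ring
    have hres : frobNorm (A - M * Φ)
        ≤ Real.sqrt C * h * Real.exp (-((k : ℝ) / Real.log L)) := by
      refine Real.sqrt_le_iff.2 ⟨by positivity, ?_⟩
      rw [mul_pow, mul_pow, Real.sq_sqrt hC.le, ← hE]
      calc ∑ i, ∑ l, (A - M * Φ) i l ^ 2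
          = ∑ i, tailEnergy V k (impulseResponse L (α i ω)) := by
            refine Finset.sum_congr rfl fun i _ => ?_
            rw [← sum_residual_sq_eq hV hk hrows]
            refine Finset.sum_congr rfl fun l _ => ?_
            rw [Matrix.mulVec_transpose]
            rfl
        _ ≤ ∑ _i : Fin h, C * h * Real.exp (-(2 * ((k : ℝ) / Real.log L))) :=
            Finset.sum_le_sum fun i _ =>
              hbound L k h hL hk hkh (Nat.one_le_of_lt i.2) V σ hV hσ hZ _ (hα i)
        _ = C * (h : ℝ) ^ 2 * Real.exp (-(2 * ((k : ℝ) / Real.log L))) := by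
            rw [Finset.sum_const, Finset.card_univ, Fintype.card_fin, nsmul_eq_mul]
            ring
    calc maxSingularValue Mt * frobNorm (A - M * Φ)
        ≤ maxSingularValue Mt * (Real.sqrt C * h * Real.exp (-((k : ℝ) / Real.log L))) :=
          mul_le_mul_of_nonneg_left hres (maxSingularValue_nonneg Mt)
      _ = _ := by ring
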